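/- Let $n\ge 1$ and let $\mathbb H^n=\mathbb C^n\times\mathbb R$ be the Heisenberg group with product $(z_1,t_1)\cdot(z_2,t_2)=(z_1+z_2,\,t_1+t_2+2\,\mathrm{Im}(z_1\cdot\overline{z_2}))$, equipped with Lebesgue measure $\mu$ (a bi-invariant Haar measure), and let $Q=2n+2$ be its homogeneous dimension. Writing $z=x+iy$, let $X_j=\partial_{x_j}+2y_j\partial_t$ and $Y_j=\partial_{y_j}-2x_j\partial_t$ ($1\le j\le n$) be the standard left-invariant horizontal vector fields, and let $\nabla_{\mathbb H^n}u=(X_1u,\dots,X_nu,Y_1u,\dots,Y_nu)$ be the subriemannian gradient, understood in the weak sense: $\int u\,X\varphi\,d\mu=-\int (Xu)\,\varphi\,d\mu$ for all $\varphi\in C_c^\infty(\mathbb H^n)$ and each $X\in\{X_j,Y_j\}$, with $u$ and $\nabla_{\mathbb H^n}u$ locally integrable. For $1\le p<\infty$ let $\|f\|_{L^{p,\infty}}=\sup_{s>0}\,s\,\mu(\{|f|>s\})^{1/p}$, and let $L^{p,\infty}(\mathbb H^n)$ be the set of measurable $f$ for which this is finite (for vector-valued $f$, $|f|$ is the Euclidean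 norm). Then there is a constant $C<\infty$, depending only on $n$, such that every real-valued $u\in L^{2,\infty}(\mathbb H^n)$ having weak subriemannian gradient $\nabla_{\mathbb H^n}u\in L^{2,\infty}(\mathbb H^n)$ satisfies $$\|u\|_{L^{\frac{2Q}{Q-2},\infty}}\le C\,\|\nabla_{\mathbb H^n}u\|_{L^{2,\infty}}.$$ In particular the left-hand side is finite. -/

import Mathlib

open MeasureTheory
open scoped ENNReal NNReal

noncomputable section

/-- The Heisenberg group `ℍⁿ`, whose underlying space is `ℂⁿ × ℝ`. A type synonym, so that its group
law does not clash with the componentwise product. -/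
def Heisenberg (n : ℕ) : Type := (Fin n → ℂ) × ℝ

namespace Heisenberg

variable {n : ℕ}

/-! The linear structure, the topology, the smooth structure and the Lebesgue measure of `ℂⁿ × ℝ`
(which is a bi-invariant Haar measure of the group law below). The norm carried by the instance is
only used for the topology and for differentiability. -/

instance : NormedAddCommGroup (Heisenberg n) :=
  inferInstanceAs (NormedAddCommGroup ((Fin n → ℂ) × ℝ))

instance : NormedSpace ℝ (Heisenberg n) :=
  inferInstanceAs (NormedSpace ℝ ((Fin n → ℂ) × ℝ))

instance : MeasureSpace (Heisenberg n) :=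
  inferInstanceAs (MeasureSpace ((Fin n → ℂ) × ℝ))

instance : BorelSpace (Heisenberg n) :=
  inferInstanceAs (BorelSpace ((Fin n → ℂ) × ℝ))

@[ext]
theorem ext {p q : Heisenberg n} (h₁ : ∀ j, p.1 j = q.1 j) (h₂ : p.2 = q.2) : p = q :=
  Prod.ext (funext h₁) h₂

/-- The group law `(z₁, t₁) · (z₂, t₂) = (z₁ + z₂, t₁ + t₂ + 2 Im (z₁ · conj z₂))`. -/
instance : Mul (Heisenberg n) where
  mul p q := (p.1 + q.1, p.2 + q.2 + 2 * (∑ j, p.1 j * starRingEnd ℂ (q.1 j)).im)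

instance : One (Heisenberg n) where
  one := (0, 0)

instance : Inv (Heisenberg n) where
  inv p := (-p.1, -p.2)

theorem mul_fst (p q : Heisenberg n) (j : Fin n) : (p * q).1 j = p.1 j + q.1 j := rfl

theorem mul_snd (p q : Heisenberg n) :
    (p * q).2 = p.2 + q.2 + 2 * (∑ j, p.1 j * starRingEnd ℂ (q.1 j)).im := rfl

theorem one_fst (j : Fin n) : (1 : Heisenberg n).1 j = 0 := rfl

theorem one_snd : (1 : Heisenberg n).2 = 0 := rfl

theorem inv_fst (p : Heisenberg n) (j : Fin n) : (p⁻¹).1 j = -p.1 j := rfl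

theorem inv_snd (p : Heisenberg n) : (p⁻¹).2 = -p.2 := rfl

instance : Group (Heisenberg n) :=
  Group.ofLeftAxioms
    (by
      intro a b c
      ext j
      · simp only [mul_fst, add_assoc]
      · simp only [mul_snd, mul_fst, map_add, add_mul, mul_add, Finset.sum_add_distrib,
          Complex.add_im]
        ring)
    (by
      intro a
      ext j
      · simp only [mul_fst, one_fst, zero_add]
      · simp [mul_snd, one_fst, one_snd])
    (by
      intro a
      ext j
      · simp only [mul_fst, inv_fst, one_fst, neg_add_cancel]
      · simp [mul_snd, inv_fst, inv_snd, one_snd, Complex.mul_conj, -Complex.mul_im])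

/-- The homogeneous dimension `Q = 2n + 2`. -/
def homDim (n : ℕ) : ℕ := 2 * n + 2

/-- The left-invariant horizontal vector fields, with `z = x + i y`:
`Sum.inl j` gives `X_j = ∂/∂x_j + 2 y_j ∂/∂t` and `Sum.inr j` gives `Y_j = ∂/∂y_j - 2 x_j ∂/∂t`. -/
def horizontalField : Fin n ⊕ Fin n → Heisenberg n → Heisenberg n
  | Sum.inl j, p => (Pi.single j 1, 2 * (p.1 j).im)
  | Sum.inr j, p => (Pi.single j Complex.I, -2 * (p.1 j).re)

/-- `g = (X_1 u, …, X_n u, Y_1 u, …, Y_n u)` is the weak subriemannian gradient of `u`: both are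
locally integrable and `∫ u X φ = - ∫ (X u) φ` for every test function `φ ∈ C_c^∞(ℍⁿ)` and each of
the (divergence-free) fields `X = X_j, Y_j`. -/
structure IsWeakGradient (u : Heisenberg n → ℝ)
    (g : Heisenberg n → EuclideanSpace ℝ (Fin n ⊕ Fin n)) : Prop where
  locallyIntegrable : LocallyIntegrable u volume
  locallyIntegrable_gradient : LocallyIntegrable g volume
  integral_eq : ∀ (i : Fin n ⊕ Fin n) (φ : Heisenberg n → ℝ),
    ContDiff ℝ (⊤ : ℕ∞) φ → HasCompactSupport φ →
      ∫ p, u p * fderiv ℝ φ p (horizontalField i p) = -∫ p, g p i * φ p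

end Heisenberg

/-- The quasinorm of the Lorentz space `L^{p,∞}` (weak `L^p`), for `0 < p < ∞`:
`sup_{s > 0} s μ{|f| > s}^{1/p}`, an extended nonnegative real. -/
def weakLpNorm {X E : Type*} [MeasurableSpace X] [NormedAddCommGroup E]
    (f : X → E) (p : ℝ) (μ : Measure X) : ℝ≥0∞ :=
  ⨆ (s : ℝ≥0) (_ : 0 < s), (s : ℝ≥0∞) * μ {x | s < ‖f x‖₊} ^ (1 / p)

/-- `f ∈ L^{p,∞}`. -/
def MemWeakLp {X E : Type*} [MeasurableSpace X] [NormedAddCommGroup E]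
    (f : X → E) (p : ℝ) (μ : Measure X) : Prop :=
  AEStronglyMeasurable f μ ∧ weakLpNorm f p μ < ∞

end

/-!
For `p > 1` the quasinorm of `L^{p,∞}` is equivalent to the norm `weakLpMeanNorm`, which is
invariant under translations and passes through averages. In this norm the translation modulus
`q ↦ ‖u(· q) - u‖` is subadditive and invariant under inversion. It is at most `|v| ‖∇u‖` at the
exponential of a horizontal vector `v`, since `u` grows along the flow at the rate `⟨v, ∇u⟩`, and at
most `2 |t|^{1/2} ‖∇u‖` at `(0, t)`, since `(0, t)` is a commutator of two horizontal elements of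
size `|t|^{1/2} / 2`, up to inversion. Writing a point of the box of radius `r` as a horizontal
times a vertical element, one gets that `u` differs from its average over the translates of the box
by a function of norm at most a constant times `r ‖∇u‖`. Comparing the averages of `|u|` at the
radii `2^k r`, which tend to `0` because `u ∈ L^{q,∞}`, bounds them by a constant times
`r^{1 - Q/p} ‖∇u‖`. So `u` splits at every scale `r` into a function bounded by `r^{1 - Q/p} ‖∇u‖`
and one of norm at most `r ‖∇u‖`, up to constants, and the choice of `r` that makes the first at
most `s / 2` controls the measure of `{|u| > s}`.
-/

/-! ### Weak Lebesgue spaces -/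

section WeakLp

open Filter Topology

theorem le_coe_mul_of_forall_nnreal_gt {a b : ℝ≥0∞} {c : ℝ≥0} (hc : c ≠ 0)
    (h : ∀ w : ℝ≥0, b < w → a ≤ c * w) : a ≤ c * b := by
  have hc0 : (c : ℝ≥0∞) ≠ 0 := ENNReal.coe_ne_zero.2 hc
  rw [mul_comm, ← ENNReal.div_le_iff hc0 ENNReal.coe_ne_top]
  refine le_of_forall_gt_imp_ge_of_dense fun w hw => ?_
  obtain ⟨v, hbv, hvw⟩ := ENNReal.lt_iff_exists_nnreal_btwn.1 hw
  refine le_trans ?_ hvw.le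
  rw [ENNReal.div_le_iff hc0 ENNReal.coe_ne_top, mul_comm]
  exact h v hbv

theorem lintegral_Ioi_mul_rpow_neg {p : ℝ} (hp : 1 < p) (c : ℝ≥0) {a : ℝ≥0} (ha : 0 < a) :
    ∫⁻ t in Set.Ioi (a : ℝ), ENNReal.ofReal (c * t ^ (-p)) =
      ENNReal.ofReal (c * (a ^ (1 - p) / (p - 1))) := by
  have hint : IntegrableOn (fun t : ℝ => c * t ^ (-p)) (Set.Ioi (a : ℝ)) :=
    (integrableOn_Ioi_rpow_of_lt (by linarith) (NNReal.coe_pos.2 ha)).const_mul _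
  have hpos : ∀ᵐ t : ℝ ∂volume.restrict (Set.Ioi (a : ℝ)), 0 ≤ c * t ^ (-p) := by
    filter_upwards [ae_restrict_mem measurableSet_Ioi] with t ht
    have : 0 < t := (NNReal.coe_pos.2 ha).trans ht
    positivity
  rw [← ofReal_integral_eq_lintegral_ofReal hint hpos, integral_const_mul,
    integral_Ioi_rpow_of_lt (by linarith) (NNReal.coe_pos.2 ha), neg_add_eq_sub, ← neg_sub p 1,
    neg_div_neg_eq]

theorem le_mul_inv_one_sub_of_le_add_succ {f : ℕ → ℝ≥0∞} {a ρ : ℝ≥0∞}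
    (hf : ∀ k, f k ≤ a * ρ ^ k + f (k + 1)) (hlim : Tendsto f atTop (𝓝 0)) :
    f 0 ≤ a * (1 - ρ)⁻¹ := by
  have hsum (m : ℕ) : f 0 ≤ a * (1 - ρ)⁻¹ + f m := by
    calc f 0 ≤ ∑ k ∈ Finset.range m, a * ρ ^ k + f m := by
          induction m with
          | zero => simp
          | succ m ih =>
            rw [Finset.sum_range_succ, add_assoc]
            exact ih.trans (by gcongr; exact hf m)
      _ ≤ a * (1 - ρ)⁻¹ + f m := by
          rw [← ENNReal.tsum_geometric, ← ENNReal.tsum_mul_left]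
          gcongr
          exact ENNReal.sum_le_tsum _
  exact ge_of_tendsto' (by simpa using hlim.const_add (a * (1 - ρ)⁻¹)) hsum

variable {X E : Type*} [MeasurableSpace X] [NormedAddCommGroup E] {f f' : X → E} {μ : Measure X}
  {p : ℝ}

theorem mul_measure_rpow_le_weakLpNorm {s : ℝ≥0} (hs : 0 < s) :
    s * μ {x | s < ‖f x‖₊} ^ (1 / p) ≤ weakLpNorm f p μ :=
  le_iSup₂ (f := fun (s : ℝ≥0) (_ : 0 < s) => (s : ℝ≥0∞) * μ {x | s < ‖f x‖₊} ^ (1 / p)) s hs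

theorem measure_lt_nnnorm_le (hp : 0 < p) {w : ℝ≥0} (hw : weakLpNorm f p μ ≤ w) {s : ℝ≥0}
    (hs : 0 < s) : μ {x | s < ‖f x‖₊} ≤ ENNReal.ofReal (w ^ p * s ^ (-p)) := by
  have hroot : μ {x | s < ‖f x‖₊} ^ (1 / p) ≤ (w / s : ℝ≥0) := by
    rw [ENNReal.coe_div hs.ne', ENNReal.le_div_iff_mul_le (.inl (by simpa using hs.ne'))
      (.inl ENNReal.coe_ne_top), mul_comm]
    exact (mul_measure_rpow_le_weakLpNorm hs).trans hw
  calc μ {x | s < ‖f x‖₊} = (μ {x | s < ‖f x‖₊} ^ (1 / p)) ^ p := by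
        rw [← ENNReal.rpow_mul, one_div_mul_cancel hp.ne', ENNReal.rpow_one]
    _ ≤ ((w / s : ℝ≥0) : ℝ≥0∞) ^ p := by gcongr
    _ = ENNReal.ofReal (w ^ p * s ^ (-p)) := by
        rw [← ENNReal.coe_rpow_of_nonneg _ hp.le, ← ENNReal.ofReal_coe_nnreal, NNReal.coe_rpow,
          NNReal.coe_div, Real.div_rpow w.coe_nonneg s.coe_nonneg, Real.rpow_neg s.coe_nonneg,
          div_eq_mul_inv]

theorem setLIntegral_enorm_le_of_weakLpNorm_le (hf : AEStronglyMeasurable f μ) (hp : 1 < p)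
    {w a : ℝ≥0} (hw : weakLpNorm f p μ ≤ w) (ha : 0 < a) (s : Set X) :
    ∫⁻ x in s, ‖f x‖ₑ ∂μ ≤ a * μ s + ENNReal.ofReal (w ^ p * (a ^ (1 - p) / (p - 1))) := by
  calc ∫⁻ x in s, ‖f x‖ₑ ∂μ = ∫⁻ t in Set.Ioi (0 : ℝ), μ.restrict s {x | t < ‖f x‖} := by
        simp_rw [← ofReal_norm]
        exact lintegral_eq_lintegral_meas_lt _ (ae_of_all _ fun _ => norm_nonneg _)
          hf.norm.aemeasurable.restrict
    _ ≤ (∫⁻ t in Set.Ioc (0 : ℝ) a, μ.restrict s {x | t < ‖f x‖}) +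
          ∫⁻ t in Set.Ioi (a : ℝ), μ.restrict s {x | t < ‖f x‖} := by
        rw [← Set.Ioc_union_Ioi_eq_Ioi a.coe_nonneg]
        exact lintegral_union_le _ _ _
    _ ≤ (∫⁻ _ in Set.Ioc (0 : ℝ) a, μ s) +
          ∫⁻ t in Set.Ioi (a : ℝ), ENNReal.ofReal ((w ^ p : ℝ≥0) * t ^ (-p)) := by
        refine add_le_add (lintegral_mono fun t => ?_)
          (setLIntegral_mono' measurableSet_Ioi fun t ht => ?_)
        · exact (measure_mono (Set.subset_univ _)).trans_eq (Measure.restrict_apply_univ s)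
        · have ht0 : 0 < t := (NNReal.coe_pos.2 ha).trans ht
          lift t to ℝ≥0 using ht0.le
          exact (Measure.restrict_apply_le _ _).trans
            (measure_lt_nnnorm_le (zero_lt_one.trans hp) hw (NNReal.coe_pos.1 ht0))
    _ = a * μ s + ENNReal.ofReal (w ^ p * (a ^ (1 - p) / (p - 1))) := by
        rw [lintegral_Ioi_mul_rpow_neg hp _ ha, setLIntegral_const, Real.volume_Ioc, sub_zero,
          ENNReal.ofReal_coe_nnreal, mul_comm, NNReal.coe_rpow]

/-- The least `N` such that `∫_s |f| ≤ N μ(s)^{1 - 1/p}` for all sets `s` of finite measure: a norm,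
equivalent to the quasinorm of `L^{p,∞}` if `1 < p < ∞`. Sets of measure `0` or `∞` contribute `0`
to the supremum. -/
noncomputable def weakLpMeanNorm (f : X → E) (p : ℝ) (μ : Measure X) : ℝ≥0∞ :=
  ⨆ s : Set X, (∫⁻ x in s, ‖f x‖ₑ ∂μ) / μ s ^ (1 - 1 / p)

theorem weakLpMeanNorm_le {N : ℝ≥0∞}
    (h : ∀ s, ∫⁻ x in s, ‖f x‖ₑ ∂μ ≤ N * μ s ^ (1 - 1 / p)) : weakLpMeanNorm f p μ ≤ N :=
  iSup_le fun s => ENNReal.div_le_of_le_mul (h s)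

theorem setLIntegral_enorm_le_weakLpMeanNorm_mul {s : Set X} (hs : μ s ≠ ∞) :
    ∫⁻ x in s, ‖f x‖ₑ ∂μ ≤ weakLpMeanNorm f p μ * μ s ^ (1 - 1 / p) := by
  rcases eq_or_ne (μ s) 0 with h0 | h0
  · simp [Measure.restrict_eq_zero.2 h0]
  · rw [← ENNReal.div_le_iff (ENNReal.rpow_pos (pos_iff_ne_zero.2 h0) hs).ne'
      (ENNReal.rpow_ne_top_of_ne_zero h0 hs)]
    exact le_iSup (fun s : Set X => (∫⁻ x in s, ‖f x‖ₑ ∂μ) / μ s ^ (1 - 1 / p)) s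

theorem truncation_balance (hp : 1 < p) {w m : ℝ} (hw : 0 < w) (hm : 0 < m) :
    w * m ^ (-1 / p) * m + w ^ p * ((w * m ^ (-1 / p)) ^ (1 - p) / (p - 1)) =
      p / (p - 1) * w * m ^ (1 - 1 / p) := by
  have hp1 : p - 1 ≠ 0 := (sub_pos.2 hp).ne'
  have hp0 : p ≠ 0 := (zero_lt_one.trans hp).ne'
  have hmul : m ^ (-1 / p) * m = m ^ (1 - 1 / p) := by
    rw [← Real.rpow_add_one hm.ne']
    ring_nf
  have hpow : w ^ p * (w * m ^ (-1 / p)) ^ (1 - p) = w * m ^ (1 - 1 / p) := by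
    rw [Real.mul_rpow hw.le (by positivity), ← mul_assoc, ← Real.rpow_add hw,
      ← Real.rpow_mul hm.le, add_sub_cancel, Real.rpow_one]
    congr 2
    field_simp
    ring
  rw [mul_assoc, hmul, ← mul_div_assoc, hpow]
  field_simp
  ring

theorem weakLpMeanNorm_le_weakLpNorm (hf : AEStronglyMeasurable f μ) (hp : 1 < p) :
    weakLpMeanNorm f p μ ≤ (p / (p - 1)).toNNReal * weakLpNorm f p μ := by
  have hp1 : 0 < p - 1 := sub_pos.2 hp
  have hp0 : 0 < p := zero_lt_one.trans hp
  have hexp : 0 < 1 - 1 / p := sub_pos.2 ((div_lt_one hp0).2 hp)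
  refine le_coe_mul_of_forall_nnreal_gt (Real.toNNReal_pos.2 (by positivity)).ne'
    fun w hw => weakLpMeanNorm_le fun s => ?_
  have hw0 : 0 < w := ENNReal.coe_pos.1 (zero_le.trans_lt hw)
  rcases eq_or_ne (μ s) 0 with h0 | h0
  · simp [Measure.restrict_eq_zero.2 h0]
  rcases eq_or_ne (μ s) ∞ with htop | htop
  · rw [htop, ENNReal.top_rpow_of_pos hexp, ENNReal.mul_top]
    · exact le_top
    · exact mul_ne_zero (by simpa using div_pos hp0 hp1) (by simpa using hw0.ne')
  -- The truncation height `w μ(s)^{-1/p}` balances the two terms.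
  lift μ s to ℝ≥0 using htop with m hm
  have hm0 : 0 < m := by simpa [pos_iff_ne_zero] using h0
  refine (setLIntegral_enorm_le_of_weakLpNorm_le hf hp hw.le
    (mul_pos hw0 (NNReal.rpow_pos hm0) : 0 < w * m ^ (-1 / p)) s).trans_eq ?_
  rw [← hm, ← ENNReal.coe_rpow_of_nonneg _ hexp.le, ← ENNReal.coe_mul, ← ENNReal.coe_mul,
    ← ENNReal.coe_mul, ← ENNReal.ofReal_coe_nnreal, ← ENNReal.ofReal_add (by positivity)
      (by positivity), ← ENNReal.ofReal_coe_nnreal]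
  push_cast
  rw [truncation_balance hp (NNReal.coe_pos.2 hw0) (NNReal.coe_pos.2 hm0),
    Real.coe_toNNReal _ (by positivity)]

theorem weakLpMeanNorm_le_mul {F : Type*} [NormedAddCommGroup F] {g : X → F} (c : ℝ≥0)
    (h : ∀ x, ‖f x‖ₑ ≤ c * ‖g x‖ₑ) : weakLpMeanNorm f p μ ≤ c * weakLpMeanNorm g p μ := by
  simp_rw [weakLpMeanNorm, ENNReal.mul_iSup, ← mul_div_assoc,
    ← lintegral_const_mul' (c : ℝ≥0∞) _ ENNReal.coe_ne_top]
  gcongr with s x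
  exact h x

theorem weakLpMeanNorm_congr_enorm (h : ∀ᵐ x ∂μ, ‖f x‖ₑ = ‖f' x‖ₑ) :
    weakLpMeanNorm f p μ = weakLpMeanNorm f' p μ := by
  refine iSup_congr fun s => ?_
  rw [lintegral_congr_ae (ae_restrict_of_ae h)]

theorem weakLpMeanNorm_add_le (hf : AEStronglyMeasurable f μ) :
    weakLpMeanNorm (f + f') p μ ≤ weakLpMeanNorm f p μ + weakLpMeanNorm f' p μ := by
  refine iSup_le fun s => ?_
  calc (∫⁻ x in s, ‖(f + f') x‖ₑ ∂μ) / μ s ^ (1 - 1 / p)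
      ≤ (∫⁻ x in s, (‖f x‖ₑ + ‖f' x‖ₑ) ∂μ) / μ s ^ (1 - 1 / p) := by
        gcongr with x
        exact enorm_add_le _ _
    _ = (∫⁻ x in s, ‖f x‖ₑ ∂μ) / μ s ^ (1 - 1 / p) +
          (∫⁻ x in s, ‖f' x‖ₑ ∂μ) / μ s ^ (1 - 1 / p) := by
        rw [lintegral_add_left' hf.enorm.restrict, ENNReal.add_div]
    _ ≤ weakLpMeanNorm f p μ + weakLpMeanNorm f' p μ :=
        add_le_add (le_iSup (fun s => (∫⁻ x in s, ‖f x‖ₑ ∂μ) / μ s ^ (1 - 1 / p)) s)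
          (le_iSup (fun s => (∫⁻ x in s, ‖f' x‖ₑ ∂μ) / μ s ^ (1 - 1 / p)) s)

theorem weakLpMeanNorm_comp_measurePreserving {Y : Type*} [MeasurableSpace Y] {ν : Measure Y}
    {e : Y ≃ᵐ X} (he : MeasurePreserving e ν μ) :
    weakLpMeanNorm (f ∘ e) p ν = weakLpMeanNorm f p μ := by
  refine (e.injective.preimage_surjective.iSup_congr _ fun s => ?_).symm
  rw [he.measure_preimage_equiv]
  exact congrArg (· / _)
    (he.setLIntegral_comp_preimage_emb e.measurableEmbedding (fun x => ‖f x‖ₑ) s)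

theorem weakLpMeanNorm_integral_le {T : Type*} [MeasurableSpace T] {ν : Measure T}
    [IsProbabilityMeasure ν] [SFinite μ] [NormedSpace ℝ E] {F : X → T → E} {N : ℝ≥0∞}
    (hF : AEStronglyMeasurable (Function.uncurry F) (μ.prod ν))
    (hN : ∀ᵐ t ∂ν, weakLpMeanNorm (F · t) p μ ≤ N) :
    weakLpMeanNorm (fun x => ∫ t, F x t ∂ν) p μ ≤ N := by
  refine iSup_le fun s => ?_
  have henorm : AEMeasurable (Function.uncurry fun x t => ‖F x t‖ₑ) ((μ.restrict s).prod ν) :=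
    hF.enorm.mono_ac (Measure.absolutelyContinuous_of_le Measure.restrict_le_self |>.prod .rfl)
  have hsection : AEMeasurable (fun t => ∫⁻ x in s, ‖F x t‖ₑ ∂μ) ν :=
    henorm.prod_swap.lintegral_prod_right'
  calc (∫⁻ x in s, ‖∫ t, F x t ∂ν‖ₑ ∂μ) / μ s ^ (1 - 1 / p)
      ≤ (∫⁻ x in s, ∫⁻ t, ‖F x t‖ₑ ∂ν ∂μ) / μ s ^ (1 - 1 / p) := by
        gcongr with x
        exact enorm_integral_le_lintegral_enorm _
    _ = ∫⁻ t, (∫⁻ x in s, ‖F x t‖ₑ ∂μ) / μ s ^ (1 - 1 / p) ∂ν := by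
        rw [lintegral_lintegral_swap henorm, div_eq_mul_inv, ← lintegral_mul_const'' _ hsection]
        rfl
    _ ≤ ∫⁻ _, N ∂ν := by
        refine lintegral_mono_ae (hN.mono fun t ht => ?_)
        exact (le_iSup (fun s => (∫⁻ x in s, ‖F x t‖ₑ ∂μ) / μ s ^ (1 - 1 / p)) s).trans ht
    _ = N := by simp

theorem measure_inter_lt_nnnorm_le (hf : AEStronglyMeasurable f μ) (hp : 0 < p) {s : ℝ≥0}
    (hs : 0 < s) {t : Set X} (ht : μ t ≠ ∞) :
    μ ({x | s < ‖f x‖₊} ∩ t) ≤ (weakLpMeanNorm f p μ / s) ^ p := by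
  set A := {x | s < ‖f x‖₊} ∩ t
  have hA : μ A ≠ ∞ := measure_ne_top_of_subset Set.inter_subset_right ht
  rcases eq_or_ne (μ A) 0 with h0 | h0
  · simp [h0]
  have hchebyshev : s * μ A ≤ weakLpMeanNorm f p μ * μ A ^ (1 - 1 / p) :=
    calc s * μ A ≤ s * μ.restrict A {x | (s : ℝ≥0∞) ≤ ‖f x‖ₑ} := by
          have hsub : A ⊆ {x | (s : ℝ≥0∞) ≤ ‖f x‖ₑ} ∩ A := fun x hx =>
            ⟨ENNReal.coe_le_coe.2 (le_of_lt hx.1), hx⟩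
          exact mul_le_mul_right ((measure_mono hsub).trans (Measure.le_restrict_apply A _)) _
      _ ≤ ∫⁻ x in A, ‖f x‖ₑ ∂μ := mul_meas_ge_le_lintegral₀ hf.enorm.restrict _
      _ ≤ _ := setLIntegral_enorm_le_weakLpMeanNorm_mul hA
  have hroot : μ A ^ (1 / p) ≤ weakLpMeanNorm f p μ / s := by
    rw [ENNReal.le_div_iff_mul_le (.inl (ENNReal.coe_ne_zero.2 hs.ne')) (.inl ENNReal.coe_ne_top),
      mul_comm]
    rwa [ENNReal.rpow_sub _ _ h0 hA, ENNReal.rpow_one, ← mul_div_assoc,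
      ENNReal.le_div_iff_mul_le, mul_right_comm, ENNReal.mul_le_mul_iff_left h0 hA] at hchebyshev
    · exact .inl (ENNReal.rpow_pos (pos_iff_ne_zero.2 h0) hA).ne'
    · exact .inl (ENNReal.rpow_ne_top_of_ne_zero h0 hA)
  calc μ A = (μ A ^ (1 / p)) ^ p := by
        rw [← ENNReal.rpow_mul, one_div_mul_cancel hp.ne', ENNReal.rpow_one]
    _ ≤ _ := by gcongr

theorem weakLpNorm_le_weakLpMeanNorm [SigmaFinite μ] (hf : AEStronglyMeasurable f μ) (hp : 0 < p) :
    weakLpNorm f p μ ≤ weakLpMeanNorm f p μ := by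
  refine iSup₂_le fun s hs => ?_
  have hlevel : μ {x | s < ‖f x‖₊} ≤ (weakLpMeanNorm f p μ / s) ^ p := by
    rw [← Measure.iSup_restrict_spanningSets]
    refine iSup_le fun k => ?_
    rw [Measure.restrict_apply' (measurableSet_spanningSets μ k)]
    exact measure_inter_lt_nnnorm_le hf hp hs (measure_spanningSets_lt_top μ k).ne
  calc s * μ {x | s < ‖f x‖₊} ^ (1 / p)
      ≤ s * ((weakLpMeanNorm f p μ / s) ^ p) ^ (1 / p) := by gcongr
    _ = weakLpMeanNorm f p μ := by
        rw [← ENNReal.rpow_mul, mul_one_div_cancel hp.ne', ENNReal.rpow_one,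
          ENNReal.mul_div_cancel (ENNReal.coe_ne_zero.2 hs.ne') ENNReal.coe_ne_top]

theorem half_mul_measure_rpow_le_weakLpNorm {g : X → E} (hp : 0 < p) {s : ℝ≥0} (hs : 0 < s)
    (h : ∀ x, ‖f x - g x‖₊ ≤ s / 2) :
    ((s / 2 : ℝ≥0) : ℝ≥0∞) * μ {x | s < ‖f x‖₊} ^ (1 / p) ≤ weakLpNorm g p μ := by
  refine le_trans ?_ (mul_measure_rpow_le_weakLpNorm (half_pos hs))
  gcongr _ * ?_ ^ _
  refine measure_mono fun x hx => ?_
  have hle : ‖f x‖₊ ≤ s / 2 + ‖g x‖₊ := by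
    simpa using (nnnorm_add_le (f x - g x) (g x)).trans (add_le_add_left (h x) _)
  exact lt_of_add_lt_add_left ((add_halves s).trans_lt (lt_of_lt_of_le hx hle))

theorem decomposition_balance {θ : ℝ} (hθ : 0 < θ) {A b s w : ℝ≥0} (hb : 0 < b)
    (hsb : s * b = 2 * w) :
    s * (b * (A * b) ^ (1 / θ)) ^ (θ / (1 + θ)) = 2 * A ^ (1 / (1 + θ)) * w := by
  have hexp : 1 / θ * (θ / (1 + θ)) = 1 / (1 + θ) := by field_simp
  have hsum : θ / (1 + θ) + 1 / (1 + θ) = 1 := by field_simp; ring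
  calc s * (b * (A * b) ^ (1 / θ)) ^ (θ / (1 + θ))
      = s * (b ^ (θ / (1 + θ)) * (A * b) ^ (1 / (1 + θ))) := by
        rw [NNReal.mul_rpow, ← NNReal.rpow_mul, hexp]
    _ = A ^ (1 / (1 + θ)) * (s * b) := by
        rw [NNReal.mul_rpow, mul_left_comm (b ^ _), ← NNReal.rpow_add hb.ne', hsum,
          NNReal.rpow_one, mul_left_comm]
    _ = 2 * A ^ (1 / (1 + θ)) * w := by
        rw [hsb]
        ring

theorem weakLpNorm_le_of_forall_decomposition {θ : ℝ} (hp : 0 < p) (hθ : 0 < θ) {A w : ℝ≥0}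
    (hA : 0 < A) (hw : 0 < w)
    (h : ∀ r : ℝ≥0, 0 < r → ∃ g : X → E,
      (∀ x, ‖f x - g x‖₊ ≤ A * w * r ^ (-θ)) ∧ weakLpNorm g p μ ≤ w * r) :
    weakLpNorm f (p * (1 + 1 / θ)) μ ≤ ↑(2 * A ^ (1 / (1 + θ)) * w) := by
  refine iSup₂_le fun s hs => ?_
  obtain ⟨b, hb⟩ : ∃ b : ℝ≥0, b = 2 * w / s := ⟨_, rfl⟩
  have hb0 : 0 < b := hb ▸ by positivity
  have hsb : s * b = 2 * w := by rw [hb, mul_div_cancel₀ _ hs.ne']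
  -- At this scale the bounded part `f - g` is at most `s / 2`.
  obtain ⟨r, hr⟩ : ∃ r : ℝ≥0, r = (A * b) ^ (1 / θ) := ⟨_, rfl⟩
  have hrθ : A * w * r ^ (-θ) = s / 2 := by
    rw [hr, ← NNReal.rpow_mul, mul_neg, one_div_mul_cancel hθ.ne', NNReal.rpow_neg_one, hb]
    field_simp
  obtain ⟨g, hfg, hg⟩ := h r (hr ▸ by positivity)
  have hroot : μ {x | s < ‖f x‖₊} ^ (1 / p) ≤ (b * r : ℝ≥0) := by
    have hle := (half_mul_measure_rpow_le_weakLpNorm (μ := μ) hp hs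
      fun x => (hfg x).trans_eq hrθ).trans hg
    rw [mul_comm, ← ENNReal.le_div_iff_mul_le (.inl (by simpa using hs.ne'))
      (.inl ENNReal.coe_ne_top), ← ENNReal.coe_mul, ← ENNReal.coe_div (half_pos hs).ne'] at hle
    refine hle.trans_eq (congrArg _ ?_)
    rw [hb]
    field_simp
  calc s * μ {x | s < ‖f x‖₊} ^ (1 / (p * (1 + 1 / θ)))
      = s * (μ {x | s < ‖f x‖₊} ^ (1 / p)) ^ (θ / (1 + θ)) := by
        rw [← ENNReal.rpow_mul]
        congr 2
        field_simp
        ring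
    _ ≤ s * ((b * r : ℝ≥0) : ℝ≥0∞) ^ (θ / (1 + θ)) := by gcongr
    _ = ↑(2 * A ^ (1 / (1 + θ)) * w) := by
        rw [← ENNReal.coe_rpow_of_nonneg _ (by positivity), ← ENNReal.coe_mul, hr,
          decomposition_balance hθ hb0 hsb]

end WeakLp

/-! ### Translations and averages on groups -/

section Translation

open ProbabilityTheory Filter Topology
open scoped commutatorElement

variable {G E : Type*} [Group G] [MeasurableSpace G] [NormedAddCommGroup E] {μ : Measure G}
  {u : G → E} {p : ℝ}

theorem quasiMeasurePreserving_mul_comp [MeasurableMul₂ G] [μ.IsMulRightInvariant] [SFinite μ]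
    {T : Type*} [MeasurableSpace T] {ν : Measure T} [SFinite ν] {γ : T → G} (hγ : Measurable γ) :
    Measure.QuasiMeasurePreserving (fun z : G × T => z.1 * γ z.2) (μ.prod ν) μ :=
  QuasiMeasurePreserving.prod_of_left (by fun_prop) <|
    ae_of_all _ fun t => (measurePreserving_mul_right μ (γ t)).quasiMeasurePreserving

theorem measurePreserving_prod_mul_comp [MeasurableMul₂ G] [μ.IsMulRightInvariant] [SFinite μ]
    {T : Type*} [MeasurableSpace T] {ν : Measure T} [SFinite ν] {γ : T → G} (hγ : Measurable γ) :
    MeasurePreserving (fun z : T × G => (z.1, z.2 * γ z.1)) (ν.prod μ) (ν.prod μ) :=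
  (MeasurePreserving.id ν).skew_product (g := fun t x => x * γ t) (by fun_prop)
    (ae_of_all _ fun t => (measurePreserving_mul_right μ (γ t)).map_eq)

/-- The size `‖u(· q) - u‖` in `L^{p,∞}` of the increments of `u` under right translation by `q`, as
a function of `q`. -/
noncomputable def translationModulus (u : G → E) (p : ℝ) (μ : Measure G) (q : G) : ℝ≥0∞ :=
  weakLpMeanNorm (fun x => u (x * q) - u x) p μ

/-- The average of `u` over the translate `x B` of the set `B`, as a function of `x`. -/
noncomputable def rightAverage [NormedSpace ℝ E] (u : G → E) (μ : Measure G) (B : Set G) (x : G) :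
    E :=
  ∫ q, u (x * q) ∂μ[|B]

variable [MeasurableMul₂ G]

section RightInvariant

variable [μ.IsMulRightInvariant]

theorem translationModulus_mul_le (hu : AEStronglyMeasurable u μ) (a b : G) :
    translationModulus u p μ (a * b) ≤ translationModulus u p μ a + translationModulus u p μ b := by
  have hsum : (fun x => u (x * (a * b)) - u x) =
      (fun x => u (x * a) - u x) + (fun x => u (x * b) - u x) ∘ MeasurableEquiv.mulRight a := by
    ext x
    simp [mul_assoc]
  have hmeas : AEStronglyMeasurable (fun x => u (x * a) - u x) μ :=
    (hu.comp_measurePreserving (measurePreserving_mul_right μ a)).sub hu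
  calc translationModulus u p μ (a * b)
      ≤ translationModulus u p μ a +
          weakLpMeanNorm ((fun x => u (x * b) - u x) ∘ MeasurableEquiv.mulRight a) p μ := by
        rw [translationModulus, hsum]
        exact weakLpMeanNorm_add_le hmeas
    _ = _ := by
        rw [weakLpMeanNorm_comp_measurePreserving (measurePreserving_mul_right μ a),
          translationModulus, translationModulus]

theorem translationModulus_inv (a : G) :
    translationModulus u p μ a⁻¹ = translationModulus u p μ a := by
  have hinv := weakLpMeanNorm_comp_measurePreserving (f := fun x => u (x * a) - u x) (p := p)
    (e := MeasurableEquiv.mulRight a⁻¹) (measurePreserving_mul_right μ a⁻¹)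
  rw [translationModulus, translationModulus, ← hinv]
  refine weakLpMeanNorm_congr_enorm (ae_of_all _ fun x => ?_)
  simp [enorm_sub_rev]

theorem translationModulus_commutator_le (hu : AEStronglyMeasurable u μ) (a b : G) :
    translationModulus u p μ ⁅a, b⁆ ≤
      2 * (translationModulus u p μ a + translationModulus u p μ b) := by
  calc translationModulus u p μ (a * b * a⁻¹ * b⁻¹)
      ≤ translationModulus u p μ a + translationModulus u p μ b + translationModulus u p μ a⁻¹ +
          translationModulus u p μ b⁻¹ := by
        refine (translationModulus_mul_le hu _ _).trans (add_le_add_left ?_ _)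
        refine (translationModulus_mul_le hu _ _).trans (add_le_add_left ?_ _)
        exact translationModulus_mul_le hu _ _
    _ = _ := by
        rw [translationModulus_inv, translationModulus_inv]
        ring

theorem aestronglyMeasurable_rightAverage [SFinite μ] [NormedSpace ℝ E] {B : Set G}
    (hu : AEStronglyMeasurable u μ) : AEStronglyMeasurable (rightAverage u μ B) μ :=
  (hu.comp_quasiMeasurePreserving
    (quasiMeasurePreserving_mul_comp (ν := μ[|B]) measurable_id)).integral_prod_right'

theorem weakLpMeanNorm_sub_rightAverage_le [SFinite μ] [NormedSpace ℝ E] [CompleteSpace E]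
    {B : Set G} (hu : AEStronglyMeasurable u μ)
    (hint : ∀ x, Integrable (fun q => u (x * q)) μ[|B]) (hB : MeasurableSet B) (h0 : μ B ≠ 0)
    (htop : μ B ≠ ∞) {N : ℝ≥0∞} (hN : ∀ q ∈ B, translationModulus u p μ q ≤ N) :
    weakLpMeanNorm (u - rightAverage u μ B) p μ ≤ N := by
  have := cond_isProbabilityMeasure_of_finite h0 htop
  have heq : ∀ x, ‖(u - rightAverage u μ B) x‖ₑ = ‖∫ q, (u (x * q) - u x) ∂μ[|B]‖ₑ := fun x => by
    rw [integral_sub (hint x) (integrable_const _), integral_const, probReal_univ, one_smul,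
      enorm_sub_rev]
    rfl
  rw [weakLpMeanNorm_congr_enorm (ae_of_all _ heq)]
  refine weakLpMeanNorm_integral_le ?_ ?_
  · exact (hu.comp_quasiMeasurePreserving (quasiMeasurePreserving_mul_comp measurable_id)).sub
      hu.comp_fst
  · filter_upwards [ae_cond_mem hB] with q hq using hN q hq

end RightInvariant

theorem lintegral_enorm_mul_cond_le [μ.IsMulLeftInvariant] {B : Set G} (h0 : μ B ≠ 0)
    (htop : μ B ≠ ∞) (x : G) :
    ∫⁻ q, ‖u (x * q)‖ₑ ∂μ[|B] ≤ weakLpMeanNorm u p μ * μ B ^ (-(1 / p)) := by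
  have hN : weakLpMeanNorm (fun q => u (x * q)) p μ = weakLpMeanNorm u p μ :=
    weakLpMeanNorm_comp_measurePreserving (e := MeasurableEquiv.mulLeft x)
      (measurePreserving_mul_left μ x)
  calc ∫⁻ q, ‖u (x * q)‖ₑ ∂μ[|B]
      = (μ B)⁻¹ * ∫⁻ q in B, ‖u (x * q)‖ₑ ∂μ := by
        rw [ProbabilityTheory.cond, lintegral_smul_measure, smul_eq_mul]
    _ ≤ (μ B)⁻¹ * (weakLpMeanNorm u p μ * μ B ^ (1 - 1 / p)) := by
        rw [← hN]
        gcongr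
        exact setLIntegral_enorm_le_weakLpMeanNorm_mul htop
    _ = weakLpMeanNorm u p μ * μ B ^ (-(1 / p)) := by
        rw [mul_left_comm, ← ENNReal.rpow_neg_one, ← ENNReal.rpow_add _ _ h0 htop]
        ring_nf

theorem integrable_mul_cond [μ.IsMulLeftInvariant] (hu : AEStronglyMeasurable u μ)
    {B : Set G} {q : ℝ} (huq : weakLpMeanNorm u q μ ≠ ∞) (h0 : μ B ≠ 0) (htop : μ B ≠ ∞) (x : G) :
    Integrable (fun q => u (x * q)) μ[|B] := by
  refine ⟨(hu.comp_measurePreserving (measurePreserving_mul_left μ x)).mono_ac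
    cond_absolutelyContinuous, (lintegral_enorm_mul_cond_le (p := q) h0 htop x).trans_lt ?_⟩
  exact ENNReal.mul_lt_top huq.lt_top (ENNReal.rpow_ne_top_of_ne_zero h0 htop).lt_top

variable [NormedSpace ℝ E] {B B' : Set G}

theorem lintegral_enorm_mul_cond_le_add [μ.IsMulLeftInvariant] (h0 : μ B ≠ 0) (htop : μ B ≠ ∞)
    (x : G) :
    ∫⁻ q, ‖u (x * q)‖ₑ ∂μ[|B] ≤ weakLpMeanNorm (u - rightAverage u μ B') p μ * μ B ^ (-(1 / p)) +
      ⨆ y, ∫⁻ q, ‖u (y * q)‖ₑ ∂μ[|B'] := by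
  have := cond_isProbabilityMeasure_of_finite h0 htop
  have haverage (y : G) : ‖rightAverage u μ B' y‖ₑ ≤ ⨆ y, ∫⁻ q, ‖u (y * q)‖ₑ ∂μ[|B'] :=
    (enorm_integral_le_lintegral_enorm _).trans
      (le_iSup (fun y => ∫⁻ q, ‖u (y * q)‖ₑ ∂μ[|B']) y)
  calc ∫⁻ q, ‖u (x * q)‖ₑ ∂μ[|B]
      ≤ ∫⁻ q, (‖(u - rightAverage u μ B') (x * q)‖ₑ +
          ⨆ y, ∫⁻ q, ‖u (y * q)‖ₑ ∂μ[|B']) ∂μ[|B] := by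
        refine lintegral_mono fun q => ?_
        calc ‖u (x * q)‖ₑ
            = ‖(u - rightAverage u μ B') (x * q) + rightAverage u μ B' (x * q)‖ₑ := by simp
          _ ≤ _ := (enorm_add_le _ _).trans (add_le_add_right (haverage _) _)
    _ ≤ _ := by
        rw [lintegral_add_right _ measurable_const, lintegral_const, measure_univ, mul_one]
        gcongr
        exact lintegral_enorm_mul_cond_le h0 htop x

end Translation

section Sobolev

open ProbabilityTheory Filter Topology

section Growth

variable {X : Type*} [MeasurableSpace X] {μ : Measure X} {p D : ℝ} {B : ℝ≥0 → Set X} {c r : ℝ≥0}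

theorem measure_ne_zero_of_eq_mul_rpow (hc : 0 < c) (hvol : ∀ r, μ (B r) = (c * r ^ D : ℝ≥0))
    (hr : 0 < r) : μ (B r) ≠ 0 := by
  rw [hvol]
  exact ENNReal.coe_ne_zero.2 (by positivity)

theorem measure_rpow_neg_eq (hc : 0 < c) (hvol : ∀ r, μ (B r) = (c * r ^ D : ℝ≥0)) (hr : 0 < r) :
    μ (B r) ^ (-(1 / p)) = (c ^ (-(1 / p)) * r ^ (-(D / p)) : ℝ≥0) := by
  rw [hvol, ← ENNReal.coe_rpow_of_ne_zero (by positivity), NNReal.mul_rpow, ← NNReal.rpow_mul,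
    mul_neg, mul_one_div]

end Growth

variable {G E : Type*} [Group G] [MeasurableSpace G] [MeasurableMul₂ G] [NormedAddCommGroup E]
  {μ : Measure G} [μ.IsMulLeftInvariant]
  {u : G → E} {p q D : ℝ} {B : ℝ≥0 → Set G} {c r w : ℝ≥0}

theorem tendsto_iSup_lintegral_cond_zero (hc : 0 < c)
    (hvol : ∀ r, μ (B r) = (c * r ^ D : ℝ≥0)) (hq : 0 < q) (hD : 0 < D)
    (huq : weakLpMeanNorm u q μ ≠ ∞) (hr : 0 < r) :
    Tendsto (fun k : ℕ => ⨆ x, ∫⁻ y, ‖u (x * y)‖ₑ ∂μ[|B (2 ^ k * r)]) atTop (𝓝 0) := by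
  have hbound (k : ℕ) : ⨆ x, ∫⁻ y, ‖u (x * y)‖ₑ ∂μ[|B (2 ^ k * r)] ≤
      weakLpMeanNorm u q μ * (c ^ (-(1 / q)) * (2 ^ k * r) ^ (-(D / q)) : ℝ≥0) := by
    rw [← measure_rpow_neg_eq hc hvol (by positivity)]
    exact iSup_le fun x => lintegral_enorm_mul_cond_le
      (measure_ne_zero_of_eq_mul_rpow hc hvol (by positivity)) (hvol _ ▸ ENNReal.coe_ne_top) x
  have hradius : Tendsto (fun k : ℕ => (2 : ℝ≥0) ^ k * r) atTop atTop :=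
    (tendsto_pow_atTop_atTop_of_one_lt one_lt_two).atTop_mul_const hr
  have hdecay : Tendsto (fun k : ℕ => c ^ (-(1 / q)) * (2 ^ k * r) ^ (-(D / q))) atTop (𝓝 0) := by
    have hpow := (tendsto_rpow_neg_atTop (div_pos hD hq)).comp (NNReal.tendsto_coe_atTop.2 hradius)
    refine NNReal.tendsto_coe.1 ?_
    simpa using hpow.const_mul ((c : ℝ) ^ (-(1 / q)))
  refine tendsto_of_tendsto_of_tendsto_of_le_of_le tendsto_const_nhds ?_ (fun _ => zero_le)
    hbound
  simpa using ENNReal.Tendsto.const_mul (ENNReal.tendsto_coe.2 hdecay) (.inr huq)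

variable [μ.IsMulRightInvariant] [SFinite μ] [NormedSpace ℝ E] [CompleteSpace E]

theorem iSup_lintegral_cond_le_add (hc : 0 < c) (hB : ∀ r, MeasurableSet (B r))
    (hvol : ∀ r, μ (B r) = (c * r ^ D : ℝ≥0)) (hu : AEStronglyMeasurable u μ)
    (huq : weakLpMeanNorm u q μ ≠ ∞) (hw : ∀ r, ∀ y ∈ B r, translationModulus u p μ y ≤ r * w)
    (hr : 0 < r) :
    ⨆ x, ∫⁻ y, ‖u (x * y)‖ₑ ∂μ[|B r] ≤
      (2 * c ^ (-(1 / p)) * w * r ^ (1 - D / p) : ℝ≥0) +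
        ⨆ x, ∫⁻ y, ‖u (x * y)‖ₑ ∂μ[|B (2 * r)] := by
  have hpos {r : ℝ≥0} (hr : 0 < r) := measure_ne_zero_of_eq_mul_rpow hc hvol hr
  have hfin (r : ℝ≥0) : μ (B r) ≠ ∞ := hvol r ▸ ENNReal.coe_ne_top
  have hr2 : 0 < 2 * r := by positivity
  have hosc : weakLpMeanNorm (u - rightAverage u μ (B (2 * r))) p μ ≤ (2 * r : ℝ≥0) * w :=
    weakLpMeanNorm_sub_rightAverage_le hu (integrable_mul_cond hu huq (hpos hr2) (hfin _)) (hB _)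
      (hpos hr2) (hfin _) (hw _)
  refine iSup_le fun x =>
    (lintegral_enorm_mul_cond_le_add (p := p) (hpos hr) (hfin r) x).trans (add_le_add_left ?_ _)
  calc _ ≤ ((2 * r : ℝ≥0) * w) * ((c ^ (-(1 / p)) * r ^ (-(D / p)) : ℝ≥0) : ℝ≥0∞) := by
        rw [measure_rpow_neg_eq hc hvol hr]
        gcongr
    _ = (2 * c ^ (-(1 / p)) * w * r ^ (1 - D / p) : ℝ≥0) := by
        rw [sub_eq_add_neg, NNReal.rpow_add hr.ne', NNReal.rpow_one]
        push_cast
        ring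

theorem iSup_lintegral_cond_le (hp : 0 < p) (hpD : p < D) (hq : 0 < q) (hc : 0 < c)
    (hB : ∀ r, MeasurableSet (B r))
    (hvol : ∀ r, μ (B r) = (c * r ^ D : ℝ≥0)) (hu : AEStronglyMeasurable u μ)
    (huq : weakLpMeanNorm u q μ ≠ ∞) (hw : ∀ r, ∀ y ∈ B r, translationModulus u p μ y ≤ r * w)
    (hr : 0 < r) :
    ⨆ x, ∫⁻ y, ‖u (x * y)‖ₑ ∂μ[|B r] ≤
      (2 * c ^ (-(1 / p)) * (1 - 2 ^ (1 - D / p))⁻¹ * w * r ^ (1 - D / p) : ℝ≥0) := by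
  have hθ : 1 - D / p < 0 := sub_neg.2 ((one_lt_div hp).2 hpD)
  have hρ : (2 : ℝ≥0) ^ (1 - D / p) < 1 := NNReal.rpow_lt_one_of_one_lt_of_neg one_lt_two hθ
  have hstep (k : ℕ) : ⨆ x, ∫⁻ y, ‖u (x * y)‖ₑ ∂μ[|B (2 ^ k * r)] ≤
      (2 * c ^ (-(1 / p)) * w * r ^ (1 - D / p) : ℝ≥0) *
          ((2 ^ (1 - D / p) : ℝ≥0) : ℝ≥0∞) ^ k +
        ⨆ x, ∫⁻ y, ‖u (x * y)‖ₑ ∂μ[|B (2 ^ (k + 1) * r)] := by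
    have hpow : ((2 : ℝ≥0) ^ k) ^ (1 - D / p) = (2 ^ (1 - D / p)) ^ k := by
      rw [← NNReal.rpow_natCast_mul, mul_comm, NNReal.rpow_mul_natCast]
    have hradius : (2 : ℝ≥0) ^ (k + 1) * r = 2 * (2 ^ k * r) := by ring
    rw [hradius]
    refine (iSup_lintegral_cond_le_add hc hB hvol hu huq hw (by positivity)).trans_eq ?_
    rw [← ENNReal.coe_pow, ← ENNReal.coe_mul, NNReal.mul_rpow, hpow, mul_assoc _ (r ^ _),
      mul_comm (r ^ _)]
  have htel := le_mul_inv_one_sub_of_le_add_succ hstep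
    (tendsto_iSup_lintegral_cond_zero hc hvol hq (hp.trans hpD) huq hr)
  rw [pow_zero, one_mul] at htel
  refine htel.trans_eq ?_
  rw [← ENNReal.coe_one, ← ENNReal.coe_sub, ← ENNReal.coe_inv (tsub_pos_of_lt hρ).ne',
    ← ENNReal.coe_mul]
  ring_nf

theorem exists_weakLpNorm_le_of_translationModulus_le [SigmaFinite μ] (hp : 0 < p) (hpD : p < D)
    (hc : 0 < c) (hB : ∀ r, MeasurableSet (B r)) (hvol : ∀ r, μ (B r) = (c * r ^ D : ℝ≥0)) :
    ∃ C : ℝ≥0, ∀ {q : ℝ}, 0 < q → ∀ {u : G → E}, AEStronglyMeasurable u μ →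
      weakLpMeanNorm u q μ ≠ ∞ → ∀ {w : ℝ≥0∞},
      (∀ r, ∀ y ∈ B r, translationModulus u p μ y ≤ r * w) →
        weakLpNorm u (p * D / (D - p)) μ ≤ C * w := by
  have hθ : 0 < D / p - 1 := sub_pos.2 ((one_lt_div hp).2 hpD)
  have hρ : (2 : ℝ≥0) ^ (1 - D / p) < 1 :=
    NNReal.rpow_lt_one_of_one_lt_of_neg one_lt_two (sub_neg.2 ((one_lt_div hp).2 hpD))
  have hgap := tsub_pos_of_lt hρ
  have hexp : p * D / (D - p) = p * (1 + 1 / (D / p - 1)) := by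
    have := (sub_pos.2 hpD).ne'
    field_simp
    ring
  set A : ℝ≥0 := 2 * c ^ (-(1 / p)) * (1 - 2 ^ (1 - D / p))⁻¹
  have hA : 0 < A := by positivity
  refine ⟨2 * A ^ (1 / (1 + (D / p - 1))), fun hq u hu huq w hw =>
    le_coe_mul_of_forall_nnreal_gt (by positivity) fun W hW => ?_⟩
  have hmodulus (r : ℝ≥0) (y : G) (hy : y ∈ B r) : translationModulus u p μ y ≤ r * W :=
    (hw r y hy).trans (by gcongr)
  rw [hexp, ← ENNReal.coe_mul]
  refine weakLpNorm_le_of_forall_decomposition hp hθ hA (ENNReal.coe_pos.1 (zero_le.trans_lt hW))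
    fun r hr => ⟨u - rightAverage u μ (B r), fun x => ?_, ?_⟩
  · rw [Pi.sub_apply, sub_sub_cancel, neg_sub, ← ENNReal.coe_le_coe]
    exact ((enorm_integral_le_lintegral_enorm _).trans (le_iSup
      (fun x => ∫⁻ y, ‖u (x * y)‖ₑ ∂μ[|B r]) x)).trans
        (iSup_lintegral_cond_le hp hpD hq hc hB hvol hu huq hmodulus hr)
  · have hpos := measure_ne_zero_of_eq_mul_rpow hc hvol hr
    have hfin : μ (B r) ≠ ∞ := hvol r ▸ ENNReal.coe_ne_top
    have hint := integrable_mul_cond hu huq hpos hfin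
    rw [mul_comm]
    refine (weakLpNorm_le_weakLpMeanNorm ?_ hp).trans
      (weakLpMeanNorm_sub_rightAverage_le hu hint (hB r) hpos hfin (hmodulus r))
    exact hu.sub (aestronglyMeasurable_rightAverage hu)

end Sobolev

/-! ### Integrability along curves of translations -/

section TranslationCurve

open scoped Pointwise

variable {G E T : Type*} [Group G] [TopologicalSpace G] [IsTopologicalGroup G] [MeasurableSpace G]
  [BorelSpace G] [SecondCountableTopology G] [T2Space G] [NormedAddCommGroup E]
  {μ : Measure G} [SFinite μ] [μ.IsMulRightInvariant]
  [TopologicalSpace T] [MeasurableSpace T] [OpensMeasurableSpace T] {ν : Measure T}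
  [IsFiniteMeasure ν] {γ : T → G} {f : G → E} {I : Set T}

theorem integrable_mul_comp_restrict (hf : LocallyIntegrable f μ) (hγ : Continuous γ)
    (hI : IsCompact I) (hν : ∀ᵐ t ∂ν, t ∈ I) {K : Set G} (hK : IsCompact K) :
    Integrable (fun z : T × G => f (z.2 * γ z.1)) (ν.prod (μ.restrict K)) := by
  have hS : IsCompact (K * γ '' I) := hK.mul (hI.image hγ)
  have hcut : Integrable ((K * γ '' I).indicator f) μ :=
    (integrable_indicator_iff hS.measurableSet).2 (hf.integrableOn_isCompact hS)
  have hshear : Integrable (fun z : T × G => (K * γ '' I).indicator f (z.2 * γ z.1)) (ν.prod μ) :=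
    (measurePreserving_prod_mul_comp hγ.measurable).integrable_comp_of_integrable
      (hcut.comp_snd ν)
  refine (hshear.mono_measure (Measure.prod_mono le_rfl Measure.restrict_le_self)).congr ?_
  filter_upwards [Measure.quasiMeasurePreserving_fst.ae hν,
    Measure.quasiMeasurePreserving_snd.ae (ae_restrict_mem hK.measurableSet)] with z hzI hzK
  exact Set.indicator_of_mem (Set.mul_mem_mul hzK (Set.mem_image_of_mem γ hzI)) f

variable [NormedSpace ℝ E]

theorem integrable_smul_mul_comp (hf : LocallyIntegrable f μ) (hγ : Continuous γ)
    (hI : IsCompact I) (hν : ∀ᵐ t ∂ν, t ∈ I) {ψ : G → ℝ} (hψ : Continuous ψ)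
    (hψc : HasCompactSupport ψ) :
    Integrable (fun z : T × G => ψ z.2 • f (z.2 * γ z.1)) (ν.prod μ) := by
  obtain ⟨C, hC⟩ := hψc.exists_bound_of_continuous hψ
  have hint : Integrable (fun z : T × G => ψ z.2 • f (z.2 * γ z.1))
      (ν.prod (μ.restrict (tsupport ψ))) :=
    (integrable_mul_comp_restrict hf hγ hI hν hψc).bdd_smul C
      (hψ.measurable.comp measurable_snd).aestronglyMeasurable (ae_of_all _ fun z => hC z.2)
  rw [← Measure.restrict_univ (μ := ν), Measure.prod_restrict] at hint
  refine (integrableOn_iff_integrable_of_support_subset fun z hz => ?_).1 hint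
  exact ⟨trivial, subset_tsupport ψ fun h => hz (by simp [h])⟩

theorem integrable_smul_comp_mul (hf : LocallyIntegrable f μ) (hγ : Continuous γ)
    (hI : IsCompact I) (hν : ∀ᵐ t ∂ν, t ∈ I) {ψ : G → ℝ} (hψ : Continuous ψ)
    (hψc : HasCompactSupport ψ) :
    Integrable (fun z : T × G => ψ (z.2 * γ z.1) • f z.2) (ν.prod μ) := by
  have h := (measurePreserving_prod_mul_comp (μ := μ) (ν := ν)
    hγ.measurable).integrable_comp_of_integrable
      (integrable_smul_mul_comp hf hγ.inv hI hν hψ hψc)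
  simpa [Function.comp_def] using h

theorem locallyIntegrable_integral_mul_comp [LocallyCompactSpace G] (hf : LocallyIntegrable f μ)
    (hγ : Continuous γ) (hI : IsCompact I) (hν : ∀ᵐ t ∂ν, t ∈ I) :
    LocallyIntegrable (fun x => ∫ t, f (x * γ t) ∂ν) μ :=
  locallyIntegrable_iff.2 fun _ hK =>
    (integrable_mul_comp_restrict hf hγ hI hν hK).integral_prod_right

end TranslationCurve

/-! ### The Heisenberg group -/

noncomputable section

namespace Heisenberg

variable {n : ℕ}

instance : FiniteDimensional ℝ (Heisenberg n) :=
  inferInstanceAs (FiniteDimensional ℝ ((Fin n → ℂ) × ℝ))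

instance : IsLocallyFiniteMeasure (volume : Measure (Heisenberg n)) :=
  inferInstanceAs (IsLocallyFiniteMeasure (volume : Measure ((Fin n → ℂ) × ℝ)))

/-- The continuous linear projection `ℍⁿ → ℂⁿ`. -/
def fstL : Heisenberg n →L[ℝ] (Fin n → ℂ) := ContinuousLinearMap.fst ℝ (Fin n → ℂ) ℝ

/-- The continuous linear projection `ℍⁿ → ℝ`. -/
def sndL : Heisenberg n →L[ℝ] ℝ := ContinuousLinearMap.snd ℝ (Fin n → ℂ) ℝ

theorem contDiff_mul {k : WithTop ℕ∞} :
    ContDiff ℝ k fun z : Heisenberg n × Heisenberg n => z.1 * z.2 := by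
  have h : ContDiff ℝ k fun z : ((Fin n → ℂ) × ℝ) × ((Fin n → ℂ) × ℝ) =>
      (z.1.1 + z.2.1, z.1.2 + z.2.2 + 2 * (∑ j, z.1.1 j * starRingEnd ℂ (z.2.1 j)).im) :=
    .prodMk (by fun_prop) <| .add (by fun_prop) <| .mul contDiff_const <|
      Complex.imCLM.contDiff.comp <| .sum fun j _ =>
        .mul (by fun_prop) (Complex.conjCLE.contDiff.comp (by fun_prop))
  exact h

theorem contDiff_mul_right (q : Heisenberg n) {k : WithTop ℕ∞} :
    ContDiff ℝ k fun p : Heisenberg n => p * q :=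
  contDiff_mul.comp (contDiff_id.prodMk contDiff_const)

instance : IsTopologicalGroup (Heisenberg n) where
  continuous_mul := (contDiff_mul (k := 0)).continuous
  continuous_inv := by
    have h : Continuous fun p : (Fin n → ℂ) × ℝ => (-p.1, -p.2) := by fun_prop
    exact h

theorem measurePreserving_shear (a : Fin n → ℂ) {f : (Fin n → ℂ) → ℝ} (hf : Continuous f) :
    MeasurePreserving (fun p : Heisenberg n => ((a + p.1, f p.1 + p.2) : Heisenberg n)) := by
  have h : MeasurePreserving (fun p : (Fin n → ℂ) × ℝ => (a + p.1, f p.1 + p.2))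
      (volume.prod volume) (volume.prod volume) :=
    (measurePreserving_add_left volume a).skew_product (g := fun z t => f z + t)
      (by fun_prop) (ae_of_all _ fun z => (measurePreserving_add_left volume (f z)).map_eq)
  exact h

instance : (volume : Measure (Heisenberg n)).IsMulLeftInvariant where
  map_mul_left_eq_self q := by
    have hshear : (fun p : Heisenberg n => q * p) = fun p =>
        (q.1 + p.1, q.2 + 2 * (∑ j, q.1 j * starRingEnd ℂ (p.1 j)).im + p.2) :=
      funext fun p => Heisenberg.ext (fun _ => rfl) (add_right_comm _ _ _)
    rw [hshear]
    exact (measurePreserving_shear q.1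
      (f := fun z => q.2 + 2 * (∑ j, q.1 j * starRingEnd ℂ (z j)).im) (by fun_prop)).map_eq

instance : (volume : Measure (Heisenberg n)).IsMulRightInvariant where
  map_mul_right_eq_self q := by
    have hshear : (fun p : Heisenberg n => p * q) = fun p =>
        (q.1 + p.1, q.2 + 2 * (∑ j, p.1 j * starRingEnd ℂ (q.1 j)).im + p.2) :=
      funext fun p => Heisenberg.ext (fun _ => add_comm _ _) (by rw [mul_snd]; ring)
    rw [hshear]
    exact (measurePreserving_shear q.1
      (f := fun z => q.2 + 2 * (∑ j, z j * starRingEnd ℂ (q.1 j)).im) (by fun_prop)).map_eq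

/-- The box `{(z, t) : |z_j| ≤ r for all j, |t| ≤ r²}`, which plays the role of the ball of radius
`r` about the identity of a homogeneous metric. -/
def box (n : ℕ) (r : ℝ≥0) : Set (Heisenberg n) := {p | ‖p.1‖ ≤ r ∧ |p.2| ≤ (r : ℝ) ^ 2}

theorem box_eq_prod (r : ℝ≥0) : box n r =
    (Metric.closedBall 0 r ×ˢ Metric.closedBall 0 ((r : ℝ) ^ 2) : Set ((Fin n → ℂ) × ℝ)) :=
  Set.ext fun _ => by
    exact and_congr mem_closedBall_zero_iff.symm (by rw [mem_closedBall_zero_iff, Real.norm_eq_abs])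

theorem measurableSet_box (r : ℝ≥0) : MeasurableSet (box n r) := by
  rw [box_eq_prod]
  exact Metric.isClosed_closedBall.measurableSet.prod Metric.isClosed_closedBall.measurableSet

theorem exists_volume_box (n : ℕ) : ∃ c : ℝ≥0, 0 < c ∧ ∀ r : ℝ≥0,
    volume (box n r) = (c * r ^ (homDim n : ℝ) : ℝ≥0) := by
  have hpos : 0 < volume (Metric.closedBall (0 : Fin n → ℂ) 1) :=
    Metric.measure_closedBall_pos _ _ one_pos
  have hfin : volume (Metric.closedBall (0 : Fin n → ℂ) 1) ≠ ∞ := measure_closedBall_lt_top.ne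
  have hrank : Module.finrank ℝ (Fin n → ℂ) = 2 * n := by
    simp [Module.finrank_pi_fintype, Complex.finrank_real_complex, mul_comm]
  refine ⟨(volume (Metric.closedBall (0 : Fin n → ℂ) 1)).toNNReal * 2,
    mul_pos (ENNReal.toNNReal_pos hpos.ne' hfin) two_pos, fun r => ?_⟩
  calc volume (box n r)
      = volume (Metric.closedBall (0 : Fin n → ℂ) r) *
          volume (Metric.closedBall (0 : ℝ) ((r : ℝ) ^ 2)) := by
        rw [box_eq_prod]
        exact Measure.prod_prod _ _
    _ = (r : ℝ≥0∞) ^ (2 * n) * volume (Metric.closedBall (0 : Fin n → ℂ) 1) *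
          (2 * (r : ℝ≥0∞) ^ 2) := by
        rw [Measure.addHaar_closedBall' _ _ r.coe_nonneg, hrank, Real.volume_closedBall,
          ENNReal.ofReal_mul two_pos.le, ENNReal.ofReal_pow r.coe_nonneg,
          ENNReal.ofReal_pow r.coe_nonneg, ENNReal.ofReal_coe_nnreal, ENNReal.ofReal_ofNat]
    _ = _ := by
        rw [NNReal.rpow_natCast, homDim, pow_add]
        push_cast [ENNReal.coe_toNNReal hfin]
        ring

/-- The left-invariant horizontal vector field `∑ᵢ vᵢ Xᵢ` with the coefficients `v` in the frame
`X_1, …, X_n, Y_1, …, Y_n`. -/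
def leftInvariantField (v : EuclideanSpace ℝ (Fin n ⊕ Fin n)) (p : Heisenberg n) : Heisenberg n :=
  ∑ i, v i • horizontalField i p

/-- The time one value of the flow of `leftInvariantField v` from the identity: the restriction of
the exponential map to the horizontal layer of the Lie algebra. -/
def horizontalExp (v : EuclideanSpace ℝ (Fin n ⊕ Fin n)) : Heisenberg n :=
  (fun j => ⟨v (Sum.inl j), v (Sum.inr j)⟩, 0)

variable (v : EuclideanSpace ℝ (Fin n ⊕ Fin n))

theorem horizontalExp_fst (j : Fin n) :
    (horizontalExp v).1 j = ⟨v (Sum.inl j), v (Sum.inr j)⟩ := rfl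

theorem horizontalExp_snd : (horizontalExp v).2 = 0 := rfl

theorem leftInvariantField_smul (τ : ℝ) (p : Heisenberg n) :
    leftInvariantField (τ • v) p = τ • leftInvariantField v p := by
  simp [leftInvariantField, Finset.smul_sum, mul_smul]

theorem leftInvariantField_fst (p : Heisenberg n) (j : Fin n) :
    (leftInvariantField v p).1 j = (horizontalExp v).1 j := by
  have hsum : (leftInvariantField v p).1 j = ∑ i, v i • (horizontalField i p).1 j :=
    (congrFun (map_sum fstL (fun i => v i • horizontalField i p) Finset.univ) j).trans
      (Finset.sum_apply j _ _)
  rw [hsum, Fintype.sum_sum_type, horizontalExp_fst, Complex.mk_eq_add_mul_I]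
  simp [horizontalField, Pi.single_apply]

theorem leftInvariantField_snd (p : Heisenberg n) :
    (leftInvariantField v p).2 =
      2 * (∑ j, p.1 j * starRingEnd ℂ ((horizontalExp v).1 j)).im := by
  have hsum : (leftInvariantField v p).2 = ∑ i, v i * (horizontalField i p).2 :=
    map_sum sndL (fun i => v i • horizontalField i p) Finset.univ
  rw [hsum, Fintype.sum_sum_type, ← Finset.sum_add_distrib, Complex.im_sum, Finset.mul_sum]
  refine Finset.sum_congr rfl fun j _ => ?_
  simp only [horizontalField, horizontalExp_fst, Complex.mul_im, Complex.conj_re, Complex.conj_im]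
  ring

theorem mul_horizontalExp (p : Heisenberg n) :
    p * horizontalExp v = p + leftInvariantField v p := by
  refine Heisenberg.ext (fun j => ?_) ?_
  · exact congrArg (p.1 j + ·) (leftInvariantField_fst v p j).symm
  · rw [mul_snd, ← leftInvariantField_snd]
    exact congrArg (· + _) (add_zero p.2)

theorem horizontalExp_smul_mul_smul (σ τ : ℝ) :
    horizontalExp (σ • v) * horizontalExp (τ • v) = horizontalExp ((σ + τ) • v) := by
  refine Heisenberg.ext (fun j => ?_) ?_
  · apply Complex.ext <;> simp [mul_fst, horizontalExp_fst, add_mul]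
  · rw [mul_snd, Complex.im_sum, Finset.sum_eq_zero fun j _ => ?_]
    · simp [horizontalExp_snd]
    · simp only [horizontalExp_fst, PiLp.smul_apply, smul_eq_mul, Complex.mul_im, Complex.conj_re,
        Complex.conj_im]
      ring

theorem horizontalExp_zero : horizontalExp (0 : EuclideanSpace ℝ (Fin n ⊕ Fin n)) = 1 := rfl

theorem horizontalExp_neg : horizontalExp (-v) = (horizontalExp v)⁻¹ := by
  rw [eq_inv_iff_mul_eq_one]
  simpa [horizontalExp_zero] using horizontalExp_smul_mul_smul v (-1) 1

theorem leftInvariantField_mul_horizontalExp_smul (p : Heisenberg n) (τ : ℝ) :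
    leftInvariantField v (p * horizontalExp (τ • v)) = leftInvariantField v p := by
  have hflow : p * horizontalExp (τ • v) * horizontalExp ((1 : ℝ) • v) =
      p + (τ + 1) • leftInvariantField v p := by
    rw [mul_assoc, horizontalExp_smul_mul_smul, mul_horizontalExp, leftInvariantField_smul]
  rw [one_smul, mul_horizontalExp, mul_horizontalExp (τ • v), leftInvariantField_smul, add_smul,
    one_smul, ← add_assoc] at hflow
  rw [mul_horizontalExp, leftInvariantField_smul]
  exact add_left_cancel hflow

theorem continuous_leftInvariantField : Continuous (leftInvariantField v) := by
  have hsub : leftInvariantField v = fun p => p * horizontalExp v - p :=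
    funext fun p => eq_sub_of_add_eq' (mul_horizontalExp v p).symm
  rw [hsub]
  fun_prop

theorem continuous_horizontalExp : Continuous (horizontalExp (n := n)) := by
  have h : Continuous fun v : EuclideanSpace ℝ (Fin n ⊕ Fin n) =>
      ((fun j => v (Sum.inl j) + v (Sum.inr j) * Complex.I, 0) : (Fin n → ℂ) × ℝ) := by fun_prop
  simp_rw [← Complex.mk_eq_add_mul_I] at h
  exact h

/-- The derivative of `φ` along the left-invariant field with the coefficients `v`. -/
def horizontalDeriv (v : EuclideanSpace ℝ (Fin n ⊕ Fin n)) (φ : Heisenberg n → ℝ)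
    (p : Heisenberg n) : ℝ :=
  fderiv ℝ φ p (leftInvariantField v p)

section TestFunction

variable {v} {φ : Heisenberg n → ℝ}

theorem continuous_horizontalDeriv (hφ : ContDiff ℝ (⊤ : ℕ∞) φ) :
    Continuous (horizontalDeriv v φ) :=
  (hφ.continuous_fderiv (by simp)).clm_apply (continuous_leftInvariantField v)

theorem hasDerivAt_comp_mul_horizontalExp (hφ : ContDiff ℝ (⊤ : ℕ∞) φ)
    (p : Heisenberg n) (τ : ℝ) :
    HasDerivAt (fun s : ℝ => φ (p * horizontalExp (s • v)))
      (horizontalDeriv v φ (p * horizontalExp (τ • v))) τ := by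
  have hcurve : HasDerivAt (fun s : ℝ => p * horizontalExp (s • v)) (leftInvariantField v p) τ := by
    simp_rw [mul_horizontalExp, leftInvariantField_smul]
    simpa using ((hasDerivAt_id τ).smul_const (leftInvariantField v p)).const_add p
  rw [horizontalDeriv, leftInvariantField_mul_horizontalExp_smul]
  exact (hφ.differentiable (by simp) _).hasFDerivAt.comp_hasDerivAt τ hcurve

theorem horizontalDeriv_comp_mul_horizontalExp (hφ : ContDiff ℝ (⊤ : ℕ∞) φ)
    (p : Heisenberg n) (τ : ℝ) :
    horizontalDeriv v (fun x => φ (x * horizontalExp (τ • v))) p =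
      horizontalDeriv v φ (p * horizontalExp (τ • v)) := by
  have hshift := hasDerivAt_comp_mul_horizontalExp (v := v)
    (hφ.comp (contDiff_mul_right (horizontalExp (τ • v)))) p 0
  have hflow := (hasDerivAt_comp_mul_horizontalExp (v := v) hφ p (0 + τ)).comp_add_const 0 τ
  simp only [Function.comp_def, mul_assoc, horizontalExp_smul_mul_smul, zero_smul,
    horizontalExp_zero, mul_one, zero_add] at hshift hflow
  exact hshift.unique hflow

theorem integral_horizontalDeriv_comp_mul_horizontalExp (hφ : ContDiff ℝ (⊤ : ℕ∞) φ)
    (p : Heisenberg n) :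
    ∫ τ in Set.Ioc (0 : ℝ) 1, horizontalDeriv v φ (p * horizontalExp (-τ • v)) =
      φ p - φ (p * (horizontalExp v)⁻¹) := by
  have hderiv : ∀ τ : ℝ, HasDerivAt (fun s : ℝ => φ (p * horizontalExp (-s • v)))
      (-horizontalDeriv v φ (p * horizontalExp (-τ • v))) τ := fun τ =>
    ((hasDerivAt_comp_mul_horizontalExp hφ p (-τ)).comp τ (hasDerivAt_neg τ)).congr_deriv
      (mul_neg_one _)
  have hcont : Continuous fun τ : ℝ => -horizontalDeriv v φ (p * horizontalExp (-τ • v)) :=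
    ((continuous_horizontalDeriv hφ).comp <| continuous_const.mul <|
      continuous_horizontalExp.comp <| by fun_prop).neg
  have hftc := intervalIntegral.integral_eq_sub_of_hasDerivAt (fun τ _ => hderiv τ)
    (hcont.intervalIntegrable 0 1)
  rw [intervalIntegral.integral_of_le zero_le_one, integral_neg, neg_zero, zero_smul,
    horizontalExp_zero, mul_one, neg_one_smul, horizontalExp_neg] at hftc
  linarith

end TestFunction

theorem hasCompactSupport_horizontalDeriv {φ : Heisenberg n → ℝ} (hφ : HasCompactSupport φ) :
    HasCompactSupport (horizontalDeriv v φ) :=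
  (hφ.fderiv ℝ).mono fun p hp h => hp (by simp [horizontalDeriv, h])

section WeakGradient

variable {u : Heisenberg n → ℝ} {g : Heisenberg n → EuclideanSpace ℝ (Fin n ⊕ Fin n)}

theorem IsWeakGradient.integral_mul_horizontalDeriv (h : IsWeakGradient u g)
    {φ : Heisenberg n → ℝ} (hφ : ContDiff ℝ (⊤ : ℕ∞) φ) (hφc : HasCompactSupport φ) :
    ∫ p, u p * horizontalDeriv v φ p = -∫ p, φ p * inner ℝ v (g p) := by
  have hfield : ∀ i p, fderiv ℝ φ p (horizontalField i p) =
      horizontalDeriv (EuclideanSpace.single i 1) φ p := fun i p => by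
    simp [horizontalDeriv, leftInvariantField, ite_smul]
  have hu : ∀ i, Integrable fun p => u p * fderiv ℝ φ p (horizontalField i p) := fun i => by
    simp_rw [hfield, mul_comm (u _)]
    exact h.locallyIntegrable.integrable_smul_left_of_hasCompactSupport
      (continuous_horizontalDeriv hφ) (hasCompactSupport_horizontalDeriv _ hφc)
  have hg : ∀ i, Integrable fun p => g p i * φ p := fun i => by
    simpa [mul_comm] using (EuclideanSpace.proj (𝕜 := ℝ) i).integrable_comp
      (h.locallyIntegrable_gradient.integrable_smul_left_of_hasCompactSupport hφ.continuous hφc)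
  calc ∫ p, u p * horizontalDeriv v φ p
      = ∫ p, ∑ i, v i * (u p * fderiv ℝ φ p (horizontalField i p)) := by
        simp only [horizontalDeriv, leftInvariantField, map_sum, map_smul, smul_eq_mul,
          Finset.mul_sum, mul_left_comm]
    _ = ∑ i, v i * ∫ p, u p * fderiv ℝ φ p (horizontalField i p) := by
        rw [integral_finsetSum _ fun i _ => (hu i).const_mul (v i)]
        simp_rw [integral_const_mul]
    _ = -∑ i, v i * ∫ p, g p i * φ p := by
        simp_rw [h.integral_eq _ φ hφ hφc, mul_neg, Finset.sum_neg_distrib]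
    _ = -∫ p, ∑ i, v i * (g p i * φ p) := by
        rw [integral_finsetSum _ fun i _ => (hg i).const_mul (v i)]
        simp_rw [integral_const_mul]
    _ = _ := by
        simp only [PiLp.inner_apply, RCLike.inner_apply, conj_trivial, Finset.mul_sum, mul_comm,
          mul_left_comm]

theorem IsWeakGradient.integral_mul_inner_comp_mul (h : IsWeakGradient u g)
    {ψ : Heisenberg n → ℝ} (hψ : ContDiff ℝ (⊤ : ℕ∞) ψ) (hψc : HasCompactSupport ψ) (τ : ℝ) :
    ∫ p, ψ p * inner ℝ v (g (p * horizontalExp (τ • v))) =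
      -∫ p, horizontalDeriv v ψ (p * horizontalExp (-τ • v)) * u p := by
  have hcancel : ∀ p : Heisenberg n, p * horizontalExp (τ • v) * horizontalExp (-τ • v) = p :=
    fun p => by
      rw [mul_assoc, horizontalExp_smul_mul_smul, add_neg_cancel, zero_smul, horizontalExp_zero,
        mul_one]
  calc ∫ p, ψ p * inner ℝ v (g (p * horizontalExp (τ • v)))
      = ∫ p, ψ (p * horizontalExp (-τ • v)) * inner ℝ v (g p) := by
        rw [← integral_mul_right_eq_self (fun p => ψ (p * horizontalExp (-τ • v)) * _)
          (horizontalExp (τ • v))]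
        simp_rw [hcancel]
    _ = -∫ p, u p * horizontalDeriv v (fun x => ψ (x * horizontalExp (-τ • v))) p :=
        (neg_eq_iff_eq_neg.2 <| h.integral_mul_horizontalDeriv v (hψ.comp (contDiff_mul_right _))
          (hψc.comp_homeomorph (Homeomorph.mulRight _))).symm
    _ = _ := by simp_rw [horizontalDeriv_comp_mul_horizontalExp hψ, mul_comm]

instance : IsProbabilityMeasure (volume.restrict (Set.Ioc (0 : ℝ) 1)) := ⟨by simp⟩

theorem IsWeakGradient.locallyIntegrable_inner (h : IsWeakGradient u g) :
    LocallyIntegrable fun p => inner ℝ v (g p) :=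
  locallyIntegrable_iff.2 fun _ hK =>
    (h.locallyIntegrable_gradient.integrableOn_isCompact hK).const_inner v

theorem IsWeakGradient.integral_mul_integral_inner (h : IsWeakGradient u g)
    {ψ : Heisenberg n → ℝ} (hψ : ContDiff ℝ (⊤ : ℕ∞) ψ) (hψc : HasCompactSupport ψ) :
    ∫ p, ψ p * ∫ τ in Set.Ioc (0 : ℝ) 1, inner ℝ v (g (p * horizontalExp (τ • v))) =
      ∫ p, ψ p * (u (p * horizontalExp v) - u p) := by
  have hIoc : ∀ᵐ τ ∂(volume.restrict (Set.Ioc (0 : ℝ) 1)), τ ∈ Set.Icc (0 : ℝ) 1 :=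
    (ae_restrict_mem measurableSet_Ioc).mono fun _ hτ => Set.Ioc_subset_Icc_self hτ
  have hg := integrable_smul_mul_comp (h.locallyIntegrable_inner v)
    (γ := fun τ : ℝ => horizontalExp (τ • v)) (continuous_horizontalExp.comp (by fun_prop))
    isCompact_Icc hIoc hψ.continuous hψc
  have hu := integrable_smul_comp_mul h.locallyIntegrable
    (γ := fun τ : ℝ => horizontalExp (-τ • v)) (continuous_horizontalExp.comp (by fun_prop))
    isCompact_Icc hIoc (continuous_horizontalDeriv (v := v) hψ)
    (hasCompactSupport_horizontalDeriv v hψc)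
  have hψu : Integrable fun p => ψ p * u p :=
    h.locallyIntegrable.integrable_smul_left_of_hasCompactSupport hψ.continuous hψc
  have hψu_translate : Integrable fun p => ψ (p * (horizontalExp v)⁻¹) * u p :=
    h.locallyIntegrable.integrable_smul_left_of_hasCompactSupport
      (hψ.continuous.comp (continuous_mul_const _)) (hψc.comp_homeomorph (Homeomorph.mulRight _))
  calc ∫ p, ψ p * ∫ τ in Set.Ioc (0 : ℝ) 1, inner ℝ v (g (p * horizontalExp (τ • v)))
      = ∫ τ in Set.Ioc (0 : ℝ) 1, ∫ p, ψ p * inner ℝ v (g (p * horizontalExp (τ • v))) := by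
        simp_rw [← integral_const_mul]
        exact (integral_integral_swap hg).symm
    _ = -∫ p, ∫ τ in Set.Ioc (0 : ℝ) 1,
          horizontalDeriv v ψ (p * horizontalExp (-τ • v)) * u p := by
        simp_rw [h.integral_mul_inner_comp_mul v hψ hψc, integral_neg]
        exact congrArg Neg.neg (integral_integral_swap hu)
    _ = -∫ p, (ψ p * u p - ψ (p * (horizontalExp v)⁻¹) * u p) := by
        simp_rw [integral_mul_const, integral_horizontalDeriv_comp_mul_horizontalExp hψ, sub_mul]
    _ = (∫ p, ψ (p * (horizontalExp v)⁻¹) * u p) - ∫ p, ψ p * u p := by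
        rw [integral_sub hψu hψu_translate, neg_sub]
    _ = ∫ p, (ψ p * u (p * horizontalExp v) - ψ p * u p) := by
        rw [integral_sub (by simpa using hψu_translate.comp_mul_right (horizontalExp v)) hψu,
          ← integral_mul_right_eq_self (fun p => ψ (p * _) * u p) (horizontalExp v)]
        simp_rw [mul_inv_cancel_right]
    _ = _ := by simp_rw [mul_sub]

theorem IsWeakGradient.ae_sub_eq_integral_inner (h : IsWeakGradient u g) :
    ∀ᵐ p, u (p * horizontalExp v) - u p =
      ∫ τ in Set.Ioc (0 : ℝ) 1, inner ℝ v (g (p * horizontalExp (τ • v))) := by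
  have htranslate : LocallyIntegrable fun p => u (p * horizontalExp v) := by
    refine (locallyIntegrable_map_homeomorph (Homeomorph.mulRight (horizontalExp v))).1 ?_
    exact (map_mul_right_eq_self volume (horizontalExp v)).symm ▸ h.locallyIntegrable
  have hintegral : LocallyIntegrable fun p =>
      ∫ τ in Set.Ioc (0 : ℝ) 1, inner ℝ v (g (p * horizontalExp (τ • v))) :=
    locallyIntegrable_integral_mul_comp (h.locallyIntegrable_inner v)
      (continuous_horizontalExp.comp (by fun_prop)) isCompact_Icc
      ((ae_restrict_mem measurableSet_Ioc).mono fun _ hτ => Set.Ioc_subset_Icc_self hτ)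
  exact ae_eq_of_integral_contDiff_smul_eq (htranslate.sub h.locallyIntegrable) hintegral
    fun ψ hψ hψc => (h.integral_mul_integral_inner v hψ hψc).symm

theorem IsWeakGradient.translationModulus_horizontalExp_le (h : IsWeakGradient u g) (p : ℝ) :
    translationModulus u p volume (horizontalExp v) ≤ ‖v‖ₑ * weakLpMeanNorm g p volume := by
  have hmeas : AEStronglyMeasurable (fun z : Heisenberg n × ℝ =>
      inner ℝ v (g (z.1 * horizontalExp (z.2 • v))))
      (volume.prod (volume.restrict (Set.Ioc (0 : ℝ) 1))) :=
    (h.locallyIntegrable_inner v).aestronglyMeasurable.comp_quasiMeasurePreserving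
      (quasiMeasurePreserving_mul_comp (γ := fun τ : ℝ => horizontalExp (τ • v))
        (continuous_horizontalExp.comp (by fun_prop)).measurable)
  rw [translationModulus, weakLpMeanNorm_congr_enorm
    ((h.ae_sub_eq_integral_inner v).mono fun _ hp => congrArg enorm hp)]
  refine weakLpMeanNorm_integral_le hmeas (ae_of_all _ fun τ => ?_)
  calc weakLpMeanNorm (fun x => inner ℝ v (g (x * horizontalExp (τ • v)))) p volume
      ≤ ‖v‖ₑ * weakLpMeanNorm (g ∘ MeasurableEquiv.mulRight (horizontalExp (τ • v))) p volume :=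
        weakLpMeanNorm_le_mul ‖v‖₊ fun x => by
          simpa [enorm_eq_nnnorm] using mod_cast nnnorm_inner_le_nnnorm (𝕜 := ℝ) v _
    _ = ‖v‖ₑ * weakLpMeanNorm g p volume := by
        rw [weakLpMeanNorm_comp_measurePreserving (measurePreserving_mul_right volume _)]

end WeakGradient

open scoped commutatorElement

/-- The element `(0, t)` of the centre of `ℍⁿ`. -/
def vertical (t : ℝ) : Heisenberg n := (0, t)

theorem vertical_fst (t : ℝ) (j : Fin n) : (vertical t : Heisenberg n).1 j = 0 := rfl

theorem vertical_snd (t : ℝ) : (vertical t : Heisenberg n).2 = t := rfl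

theorem vertical_neg (t : ℝ) : vertical (-t) = (vertical t : Heisenberg n)⁻¹ :=
  Heisenberg.ext (fun _ => neg_zero.symm) rfl

theorem commutatorElement_eq_vertical (p q : Heisenberg n) :
    ⁅p, q⁆ = vertical (4 * (∑ j, p.1 j * starRingEnd ℂ (q.1 j)).im) := by
  rw [commutatorElement_def, mul_inv_eq_iff_eq_mul, mul_inv_eq_iff_eq_mul, mul_assoc]
  refine Heisenberg.ext (fun j => ?_) ?_
  · simp only [mul_fst, vertical_fst, zero_add, add_comm]
  · have hskew : (∑ j, q.1 j * starRingEnd ℂ (p.1 j)).im =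
        -(∑ j, p.1 j * starRingEnd ℂ (q.1 j)).im := by
      rw [← Complex.conj_im, map_sum]
      simp only [map_mul, Complex.conj_conj, mul_comm]
    simp only [mul_snd, vertical_fst, vertical_snd, zero_mul, Finset.sum_const_zero,
      Complex.zero_im, hskew]
    ring

theorem commutatorElement_horizontalExp_single (j : Fin n) (a b : ℝ) :
    ⁅horizontalExp (EuclideanSpace.single (Sum.inr j) a),
      horizontalExp (EuclideanSpace.single (Sum.inl j) b)⁆ = vertical (4 * (a * b)) := by
  rw [commutatorElement_eq_vertical, Complex.im_sum, Finset.sum_eq_single j]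
  · simp [horizontalExp_fst]
  · intro i _ hij
    simp [horizontalExp_fst, hij]
  · simp

theorem exists_eq_horizontalExp_mul_vertical {r : ℝ≥0} {q : Heisenberg n} (hq : q ∈ box n r) :
    ∃ v : EuclideanSpace ℝ (Fin n ⊕ Fin n), ‖v‖₊ ≤ NNReal.sqrt n * r ∧
      q = horizontalExp v * vertical q.2 := by
  refine ⟨WithLp.toLp 2 (Sum.elim (fun j => (q.1 j).re) fun j => (q.1 j).im), ?_, ?_⟩
  · rw [← NNReal.coe_le_coe, coe_nnnorm, NNReal.coe_mul, Real.coe_sqrt]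
    refine le_of_sq_le_sq ?_ (by positivity)
    calc _ = ∑ j, ‖q.1 j‖ ^ 2 := by
          rw [EuclideanSpace.norm_sq_eq, Fintype.sum_sum_type, ← Finset.sum_add_distrib]
          simp [Complex.sq_norm, Complex.normSq_apply, ← sq]
      _ ≤ ∑ _j : Fin n, (r : ℝ) ^ 2 := by
          gcongr with j
          exact (norm_le_pi_norm q.1 j).trans hq.1
      _ = _ := by simp [mul_pow]
  · refine Heisenberg.ext (fun j => ?_) ?_
    · apply Complex.ext <;> simp [mul_fst, horizontalExp_fst, vertical_fst]
    · simp [mul_snd, horizontalExp_snd, vertical_fst, vertical_snd]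

section Increments

variable {u : Heisenberg n → ℝ} {g : Heisenberg n → EuclideanSpace ℝ (Fin n ⊕ Fin n)}

theorem IsWeakGradient.translationModulus_vertical_sq_le (h : IsWeakGradient u g) (j : Fin n)
    (p : ℝ) (s : ℝ≥0) :
    translationModulus u p volume (vertical (s ^ 2)) ≤ 2 * s * weakLpMeanNorm g p volume := by
  have hsingle (i : Fin n ⊕ Fin n) :
      translationModulus u p volume (horizontalExp (EuclideanSpace.single i (s / 2 : ℝ))) ≤
        s / 2 * weakLpMeanNorm g p volume := by
    have hnorm : ‖EuclideanSpace.single i (s / 2 : ℝ)‖ₑ = s / 2 := by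
      rw [← ofReal_norm, PiLp.norm_single, Real.norm_of_nonneg (by positivity),
        ENNReal.ofReal_div_of_pos two_pos, ENNReal.ofReal_coe_nnreal, ENNReal.ofReal_ofNat]
    exact hnorm ▸ h.translationModulus_horizontalExp_le _ p
  have hcomm := translationModulus_commutator_le (p := p) h.locallyIntegrable.aestronglyMeasurable
    (horizontalExp (EuclideanSpace.single (Sum.inr j) (s / 2 : ℝ)))
    (horizontalExp (EuclideanSpace.single (Sum.inl j) (s / 2 : ℝ)))
  rw [commutatorElement_horizontalExp_single, show 4 * ((s : ℝ) / 2 * (s / 2)) = s ^ 2 by ring]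
    at hcomm
  calc _ ≤ _ := hcomm
    _ ≤ 2 * (s / 2 * weakLpMeanNorm g p volume + s / 2 * weakLpMeanNorm g p volume) := by
        gcongr <;> exact hsingle _
    _ = _ := by rw [← add_mul, ENNReal.add_halves, mul_assoc]

theorem IsWeakGradient.translationModulus_vertical_le (h : IsWeakGradient u g) (j : Fin n)
    (p t : ℝ) :
    translationModulus u p volume (vertical t) ≤
      2 * NNReal.sqrt ‖t‖₊ * weakLpMeanNorm g p volume := by
  have hsq : ((NNReal.sqrt ‖t‖₊ : ℝ≥0) : ℝ) ^ 2 = |t| := by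
    rw [← NNReal.coe_pow, NNReal.sq_sqrt, coe_nnnorm, Real.norm_eq_abs]
  have habs := h.translationModulus_vertical_sq_le j p (NNReal.sqrt ‖t‖₊)
  rw [hsq] at habs
  rcases abs_choice t with ht | ht
  · rwa [ht] at habs
  · rwa [ht, vertical_neg, translationModulus_inv] at habs

theorem IsWeakGradient.translationModulus_le_of_mem_box (h : IsWeakGradient u g) (hn : 1 ≤ n)
    (p : ℝ) {r : ℝ≥0} {q : Heisenberg n} (hq : q ∈ box n r) :
    translationModulus u p volume q ≤
      r * ((NNReal.sqrt n + 2 : ℝ≥0) * weakLpMeanNorm g p volume) := by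
  obtain ⟨v, hv, hqv⟩ := exists_eq_horizontalExp_mul_vertical hq
  have ht : NNReal.sqrt ‖q.2‖₊ ≤ r := NNReal.sqrt_le_iff_le_sq.2 hq.2
  calc translationModulus u p volume q
      ≤ translationModulus u p volume (horizontalExp v) +
          translationModulus u p volume (vertical q.2) := by
        conv_lhs => rw [hqv]
        exact translationModulus_mul_le h.locallyIntegrable.aestronglyMeasurable _ _
    _ ≤ ‖v‖ₑ * weakLpMeanNorm g p volume +
          2 * NNReal.sqrt ‖q.2‖₊ * weakLpMeanNorm g p volume :=
        add_le_add (h.translationModulus_horizontalExp_le v p)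
          (h.translationModulus_vertical_le ⟨0, hn⟩ p q.2)
    _ ≤ (NNReal.sqrt n * r : ℝ≥0) * weakLpMeanNorm g p volume +
          2 * r * weakLpMeanNorm g p volume := by
        gcongr
        exact ENNReal.coe_le_coe.2 hv
    _ = _ := by
        push_cast
        ring

end Increments

end Heisenberg

end

theorem mainTheorem5_general (n : ℕ) (hn : 1 ≤ n) {p : ℝ} (hp : 1 < p)
    (hpQ : p < Heisenberg.homDim n) :
    ∃ C : ℝ≥0, ∀ {q : ℝ}, 1 < q → ∀ (u : Heisenberg n → ℝ)
      (g : Heisenberg n → EuclideanSpace ℝ (Fin n ⊕ Fin n)),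
      MemWeakLp u q volume → Heisenberg.IsWeakGradient u g →
        weakLpNorm u (p * (Heisenberg.homDim n : ℝ) / ((Heisenberg.homDim n : ℝ) - p)) volume
          ≤ (C : ℝ≥0∞) * weakLpNorm g p volume := by
  obtain ⟨c, hc, hvol⟩ := Heisenberg.exists_volume_box n
  obtain ⟨C, hC⟩ := exists_weakLpNorm_le_of_translationModulus_le (E := ℝ)
    (zero_lt_one.trans hp) hpQ hc Heisenberg.measurableSet_box hvol
  refine ⟨C * (NNReal.sqrt n + 2) * (p / (p - 1)).toNNReal, fun {q} hq u g hu h => ?_⟩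
  have hfinite : weakLpMeanNorm u q volume ≠ ∞ :=
    ne_top_of_le_ne_top (ENNReal.mul_ne_top ENNReal.coe_ne_top hu.2.ne)
      (weakLpMeanNorm_le_weakLpNorm hu.1 hq)
  calc weakLpNorm u (p * (Heisenberg.homDim n : ℝ) / ((Heisenberg.homDim n : ℝ) - p)) volume
      ≤ C * ((NNReal.sqrt n + 2 : ℝ≥0) * weakLpMeanNorm g p volume) :=
        hC (zero_lt_one.trans hq) hu.1 hfinite fun r y hy =>
          h.translationModulus_le_of_mem_box hn p hy
    _ ≤ C * ((NNReal.sqrt n + 2 : ℝ≥0) *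
          ((p / (p - 1)).toNNReal * weakLpNorm g p volume)) := by
        gcongr
        exact weakLpMeanNorm_le_weakLpNorm h.locallyIntegrable_gradient.aestronglyMeasurable hp
    _ = _ := by
        push_cast
        ring

theorem mainTheorem5 (n : ℕ) (hn : 1 ≤ n) :
    ∃ C : ℝ≥0, ∀ (u : Heisenberg n → ℝ)
      (g : Heisenberg n → EuclideanSpace ℝ (Fin n ⊕ Fin n)),
      MemWeakLp u 2 volume → Heisenberg.IsWeakGradient u g → MemWeakLp g 2 volume →
        weakLpNorm u (2 * (Heisenberg.homDim n : ℝ) / ((Heisenberg.homDim n : ℝ) - 2)) volume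
          ≤ (C : ℝ≥0∞) * weakLpNorm g 2 volume := by
  have hQ : (2 : ℝ) < Heisenberg.homDim n := by exact_mod_cast (by unfold Heisenberg.homDim; omega)
  obtain ⟨C, hC⟩ := mainTheorem5_general n hn one_lt_two hQ
  exact ⟨C, fun u g hu h _ => hC one_lt_two u g hu h⟩
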